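/- **Theorem 4.2.** Let $n\ge 1$, $0\le s\le n-1$ and $\ell\ge 1$ be integers. Let $\Gamma$ be the simplex on the vertex set $V=\{x_1,\dots,x_n\}$, let $\Gamma^{(s)}=\{F\in\Gamma : |F|\le s+1\}$ be its $s$-skeleton, and let $\mathcal H=\mathcal H(\Gamma^{(s)})$ be the hypergraph on $V$ whose edges are the facets of $\Gamma^{(s)}$. Let $\mathcal H(\ell)$ be the hypergraph with vertices $x_{i,c}$ ($1\le i\le n$, $1\le c\le \ell$) whose edges are the sets $\{x_{j_1,f_1},\dots,x_{j_a,f_a}\}$, where $\{x_{j_1},\dots,x_{j_a}\}$ is an edge of $\mathcal H$ with $a$ elements, $1\le f_q\le \ell$ for all $q$, and $f_1+\dots+f_a\le \ell+a-1$. Then: 1. $\mathcal H(\ell)$ is vertex decomposable. 2. The shedding vertices can be taken minimal in the shadow order: $\mathcal H(\ell)$ belongs to the smallest class $\mathcal D$ of hypergraphs with vertices among the $x_{i,c}$ such that (a) $\mathcal D$ contains every hypergraph all of whose vertices are isolated, and (b) if the $\prec_s$-least non-isolated vertex $x$ of $\mathcal G$ exists and is a shedding vertex of $\mathcal G$, and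 both $\mathcal G\setminus x$ and $\mathcal G/x$ are in $\mathcal D$, then $\mathcal G$ is in $\mathcal D$. Here a shedding vertex of a simplicial complex $\Delta$ is a vertex $x$ such that every face of $\operatorname{link}_\Delta(x)$ is properly contained in a face of $\operatorname{del}_\Delta(x)$. The complex $\Delta$ is vertex decomposable if it is a simplex (has exactly one facet) or has a shedding vertex $x$ such that $\operatorname{del}_\Delta(x)$ and $\operatorname{link}_\Delta(x)$ are vertex decomposable. A hypergraph is vertex decomposable if its independence complex (the vertex sets containing no edge) is, and its shedding vertices are those of its independence complex. A vertex $x$ of a hypergraph is isolated if $\{x\}$ is an edge or no edge contains $x$. Both $\mathcal G\setminus x$ and $\mathcal G/x$ have vertex set $V(\mathcal G)\setminus\{x\}$. The edges of $\mathcal G\setminus x$ are the edges of $\mathcal G$ not containing $x$. The edges of $\mathcal G/x$ are the sets $E\setminus\{x\}$ for edges $E\ni x$, together with the edges $E\not\ni x$ such that $F\setminus\{x\}\not\subseteq E$ for every edge $F\ne E$. The shadow order is $x_{i,c}\prec_s x_{j,d}$ if $c<d$, or $c=d$ and $i<j$. -/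

import Mathlib

namespace SkeletonVD

/-- An abstract simplicial complex: a family of finite sets closed under passing to subsets.
The empty set counts as a face, so the complex `{∅}` (a simplex whose only facet is `∅`) differs
from the complex without faces; Mathlib's complexes have only nonempty faces. -/
@[ext]
structure AbsComplex (α : Type*) where
  /-- the faces -/
  faces : Set (Finset α)
  /-- subsets of faces are faces -/
  down_closed : ∀ F ∈ faces, ∀ G : Finset α, G ⊆ F → G ∈ faces

namespace AbsComplex

variable {α : Type*}

/-- The vertex set of a complex. -/
def vertexSet (Δ : AbsComplex α) : Set α := {x | {x} ∈ Δ.faces}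

/-- A facet is a face that is maximal under inclusion. -/
def IsFacet (Δ : AbsComplex α) (F : Finset α) : Prop :=
  F ∈ Δ.faces ∧ ∀ G ∈ Δ.faces, F ⊆ G → F = G

/-- A simplex is a complex with exactly one facet. -/
def IsSimplex (Δ : AbsComplex α) : Prop := ∃! F : Finset α, Δ.IsFacet F

/-- The `s`-th skeleton: all faces of dimension `|F| - 1 ≤ s`. -/
def skeleton (Δ : AbsComplex α) (s : ℕ) : AbsComplex α where
  faces := {F | F ∈ Δ.faces ∧ F.card ≤ s + 1}
  down_closed := fun F hF G hG =>
    ⟨Δ.down_closed F hF.1 G hG, (Finset.card_le_card hG).trans hF.2⟩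

/-- The deletion of a vertex: the faces `G` with `G ∩ {x} = ∅`. -/
def deletion (Δ : AbsComplex α) (x : α) : AbsComplex α where
  faces := {G | G ∈ Δ.faces ∧ x ∉ G}
  down_closed := fun F hF G hG => ⟨Δ.down_closed F hF.1 G hG, fun hx => hF.2 (hG hx)⟩

open Classical in
/-- The link of a vertex: the faces `G` with `G ∩ {x} = ∅` and `G ∪ {x}` a face. -/
noncomputable def link (Δ : AbsComplex α) (x : α) : AbsComplex α where
  faces := {G | G ∈ Δ.faces ∧ x ∉ G ∧ insert x G ∈ Δ.faces}
  down_closed := fun F hF G hG =>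
    ⟨Δ.down_closed F hF.1 G hG, fun hx => hF.2.1 (hG hx),
      Δ.down_closed _ hF.2.2 _ (Finset.insert_subset_insert x hG)⟩

/-- A shedding vertex: a vertex `x` such that every face of the link of `x` is properly contained
in some face of the deletion of `x`. -/
def IsSheddingVertex (Δ : AbsComplex α) (x : α) : Prop :=
  x ∈ Δ.vertexSet ∧ ∀ F ∈ (Δ.link x).faces, ∃ F' ∈ (Δ.deletion x).faces, F ⊂ F'

/-- Vertex decomposability (no purity assumption): `Δ` is a simplex, or it has a shedding vertex
whose deletion and link are vertex decomposable. -/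
inductive VertexDecomposable : AbsComplex α → Prop
  | simplex (Δ : AbsComplex α) : Δ.IsSimplex → VertexDecomposable Δ
  | shed (Δ : AbsComplex α) (x : α) : Δ.IsSheddingVertex x →
      VertexDecomposable (Δ.deletion x) → VertexDecomposable (Δ.link x) → VertexDecomposable Δ

/-- The facet hypergraph `(V, facets)` of a complex with vertex set `V`. -/
def facetHypergraph (Δ : AbsComplex α) : Hypergraph α where
  vertexSet := Δ.vertexSet
  edgeSet := {e | ∃ F : Finset α, Δ.IsFacet F ∧ e = (F : Set α)}
  subset_vertexSet_of_mem_edgeSet' := by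
    rintro e ⟨F, hF, rfl⟩ x hx
    exact Δ.down_closed F hF.1 {x} (Finset.singleton_subset_iff.2 (Finset.mem_coe.1 hx))

end AbsComplex

variable {α : Type*}

/-- The independence complex of a hypergraph: its faces are the finite sets of vertices that
contain no edge. -/
def independenceComplex (H : Hypergraph α) : AbsComplex α where
  faces := {S | (S : Set α) ⊆ H.vertexSet ∧ ∀ e ∈ H.edgeSet, ¬ e ⊆ (S : Set α)}
  down_closed := fun F hF G hG =>
    ⟨fun _ hx => hF.1 (hG hx), fun e he heG => hF.2 e he fun _ hx => hG (heG hx)⟩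

/-- A hypergraph is vertex decomposable if its independence complex is. -/
def IsVertexDecomposable (H : Hypergraph α) : Prop :=
  (independenceComplex H).VertexDecomposable

/-- A shedding vertex of a hypergraph is a shedding vertex of its independence complex. -/
def IsShedding (H : Hypergraph α) (x : α) : Prop :=
  (independenceComplex H).IsSheddingVertex x

/-- A vertex `x` is isolated if `{x}` is an edge or no edge contains `x`. -/
def IsIsolated (H : Hypergraph α) (x : α) : Prop :=
  x ∈ H.vertexSet ∧ ({x} ∈ H.edgeSet ∨ ∀ e ∈ H.edgeSet, x ∉ e)

/-- The set of non-isolated vertices. -/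
def nonisolatedSet (H : Hypergraph α) : Set α := {x | x ∈ H.vertexSet ∧ ¬ IsIsolated H x}

/-- The deletion `H \ x`. -/
def deleteVertex (H : Hypergraph α) (x : α) : Hypergraph α where
  vertexSet := H.vertexSet \ {x}
  edgeSet := {e | e ∈ H.edgeSet ∧ x ∉ e}
  subset_vertexSet_of_mem_edgeSet' := by
    rintro e ⟨he, hx⟩ y hy
    exact ⟨H.subset_vertexSet_of_mem_edgeSet' he hy, fun h => hx (h ▸ hy)⟩

/-- The contraction `H / x`: the edges are the sets `E \ {x}` for the edges `E` containing `x`,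
together with the edges `E` not containing `x` such that `F \ {x} ⊄ E` for all edges `F ≠ E`. -/
def contractVertex (H : Hypergraph α) (x : α) : Hypergraph α where
  vertexSet := H.vertexSet \ {x}
  edgeSet := {e | ∃ E ∈ H.edgeSet, x ∈ E ∧ e = E \ {x}} ∪
    {E | E ∈ H.edgeSet ∧ x ∉ E ∧ ∀ F ∈ H.edgeSet, F ≠ E → ¬ F \ {x} ⊆ E}
  subset_vertexSet_of_mem_edgeSet' := by
    rintro e (⟨E, hE, -, rfl⟩ | ⟨he, hx, -⟩) y hy
    · exact ⟨H.subset_vertexSet_of_mem_edgeSet' hE hy.1, hy.2⟩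
    · exact ⟨H.subset_vertexSet_of_mem_edgeSet' he hy, fun h => hx (h ▸ hy)⟩

/-- The duplicated hypergraph `H(ℓ)`, for `ℓ ≥ 1`; the pair `(x, c)` is the `c`-th shadow of `x`.
Each finite edge `F` of `H` gives the shadows `(x, c)` with `x ∈ F` and `1 ≤ c ≤ ℓ` as vertices,
and gives one edge `{(x, f x) : x ∈ F}` for every `f : F → {1, …, ℓ}` with
`∑ x ∈ F, f x ≤ ℓ + |F| - 1`. -/
def duplicate (H : Hypergraph α) (ℓ : ℕ) : Hypergraph (α × ℕ) where
  vertexSet := {p | ∃ F : Finset α, (F : Set α) ∈ H.edgeSet ∧ p.1 ∈ F ∧ 1 ≤ p.2 ∧ p.2 ≤ ℓ}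
  edgeSet := {e | ∃ F : Finset α, (F : Set α) ∈ H.edgeSet ∧
    ∃ f : α → ℕ, (∀ x ∈ F, 1 ≤ f x ∧ f x ≤ ℓ) ∧ (∑ x ∈ F, f x) + 1 ≤ ℓ + F.card ∧
      e = (fun x => (x, f x)) '' (F : Set α)}
  subset_vertexSet_of_mem_edgeSet' := by
    rintro e ⟨F, hF, f, hf, -, rfl⟩ p ⟨x, hx, rfl⟩
    exact ⟨F, hF, hx, hf x hx⟩

/-- The order induced by shadows: `x_{i,c} ≺ x_{j,d}` if `c < d`, or `c = d` and `i < j`. -/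
def ShadowLT {n : ℕ} (p q : Fin n × ℕ) : Prop :=
  p.2 < q.2 ∨ (p.2 = q.2 ∧ p.1 < q.1)

/-- `x` is the minimum of the set `S` in the order induced by shadows. -/
def IsShadowMin {n : ℕ} (S : Set (Fin n × ℕ)) (x : Fin n × ℕ) : Prop :=
  x ∈ S ∧ ∀ y ∈ S, y ≠ x → ShadowLT x y

/-- Vertex decomposability along the order induced by shadows: every vertex of `H` is isolated, or
the minimal non-isolated vertex `x` is a shedding vertex of `H`, and `H \ x` and `H / x` are again
vertex decomposable along this order. -/
inductive ShadowDecomposable {n : ℕ} : Hypergraph (Fin n × ℕ) → Prop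
  | isolated (H : Hypergraph (Fin n × ℕ)) :
      (∀ x ∈ H.vertexSet, IsIsolated H x) → ShadowDecomposable H
  | shed (H : Hypergraph (Fin n × ℕ)) (x : Fin n × ℕ) :
      IsShadowMin (nonisolatedSet H) x → IsShedding H x →
      ShadowDecomposable (deleteVertex H x) → ShadowDecomposable (contractVertex H x) →
      ShadowDecomposable H

end SkeletonVD

namespace SkeletonVD

/-! The facets of the skeleton are all `(s+1)`-subsets, so the edges of the duplicated hypergraph
are the `(s+1)`-element transversals of the rows with positive weights of sum at most `ℓ + s`. The
induction runs over a larger class: light transversals of a set `U` closed under raising weights.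

Let `x` be the least nonisolated vertex, and let edges have at least two elements. Then `x` has the
least weight among all vertices on edges, so in any edge some element can be exchanged for `x`.
Hence the edges avoiding `x` are redundant in the contraction. Deletion and contraction stay in the
class: the first removes `x` from `U`, the second removes the row of `x` and lowers the size by one
and the weight bound by the weight of `x`. The exchange also makes `x` a shedding vertex
(`isShedding`). When edges are singletons, every vertex is isolated and the independence complex is
a simplex. -/

/-- A light transversal: a `k`-element subset of `U` whose first coordinates are distinct and whose
second coordinates sum to at most `M`. -/
structure IsLightTransversal {ι : Type*} (U : Set (ι × ℕ)) (k M : ℕ) (E : Finset (ι × ℕ)) :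
    Prop where
  subset : (E : Set (ι × ℕ)) ⊆ U
  injOn : Set.InjOn Prod.fst (E : Set (ι × ℕ))
  card_eq : E.card = k
  sum_le : ∑ p ∈ E, p.2 ≤ M

/-- The edges of `H` are the light transversals of a set `U` that is upward closed in the second
coordinate. -/
structure IsLightTransversalHypergraph {ι : Type*} (H : Hypergraph (ι × ℕ)) (U : Set (ι × ℕ))
    (k M : ℕ) : Prop where
  mem_edgeSet : ∀ e, e ∈ H.edgeSet ↔
    ∃ E : Finset (ι × ℕ), IsLightTransversal U k M E ∧ (E : Set (ι × ℕ)) = e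
  upward : ∀ i c, (i, c) ∈ U → (i, c + 1) ∈ U

/-! ### Exchanging, removing and adding elements of light transversals -/

namespace IsLightTransversal

variable {ι : Type*} [DecidableEq ι] {U : Set (ι × ℕ)} {k M : ℕ} {E : Finset (ι × ℕ)}

theorem exchange (hE : IsLightTransversal U k M E) {x y : ι × ℕ} (hy : y ∈ E) (hxU : x ∈ U)
    (hx : ∀ z ∈ E, z ≠ y → z.1 ≠ x.1) (hsum : ∑ p ∈ E, p.2 + x.2 ≤ M + y.2) :
    IsLightTransversal U k M (insert x (E.erase y)) := by
  have hxE : x ∉ E.erase y := fun h =>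
    hx x (Finset.mem_of_mem_erase h) (Finset.ne_of_mem_erase h) rfl
  refine ⟨?_, ?_, ?_, ?_⟩
  · intro z hz
    rcases Finset.mem_insert.1 (Finset.mem_coe.1 hz) with rfl | hz
    · exact hxU
    · exact hE.subset (Finset.mem_of_mem_erase hz)
  · intro a ha b hb hab
    rcases Finset.mem_insert.1 (Finset.mem_coe.1 ha) with rfl | ha' <;>
      rcases Finset.mem_insert.1 (Finset.mem_coe.1 hb) with rfl | hb'
    · rfl
    · exact absurd hab.symm (hx b (Finset.mem_of_mem_erase hb') (Finset.ne_of_mem_erase hb'))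
    · exact absurd hab (hx a (Finset.mem_of_mem_erase ha') (Finset.ne_of_mem_erase ha'))
    · exact hE.injOn (Finset.mem_of_mem_erase ha') (Finset.mem_of_mem_erase hb') hab
  · rw [Finset.card_insert_of_notMem hxE, Finset.card_erase_add_one hy, hE.card_eq]
  · rw [Finset.sum_insert hxE]
    have := Finset.add_sum_erase E (fun p : ι × ℕ => p.2) hy
    omega

theorem erase (hE : IsLightTransversal U (k + 1) M E) {x : ι × ℕ} (hx : x ∈ E) :
    IsLightTransversal {p | p ∈ U ∧ p.1 ≠ x.1} k (M - x.2) (E.erase x) := by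
  refine ⟨?_, ?_, ?_, ?_⟩
  · intro z hz
    have hz := Finset.mem_coe.1 hz
    exact ⟨hE.subset (Finset.mem_of_mem_erase hz), fun h =>
      Finset.ne_of_mem_erase hz (hE.injOn (Finset.mem_of_mem_erase hz) hx h)⟩
  · exact hE.injOn.mono (Finset.coe_subset.2 (Finset.erase_subset x E))
  · rw [Finset.card_erase_of_mem hx, hE.card_eq, Nat.add_sub_cancel]
  · have := Finset.add_sum_erase E (fun p : ι × ℕ => p.2) hx
    have := hE.sum_le
    omega

theorem insert {x : ι × ℕ} (hE : IsLightTransversal {p | p ∈ U ∧ p.1 ≠ x.1} k (M - x.2) E)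
    (hx : x ∈ U) (hM : x.2 ≤ M) : x ∉ E ∧ IsLightTransversal U (k + 1) M (insert x E) := by
  have hxE : x ∉ E := fun h => (hE.subset h).2 rfl
  refine ⟨hxE, ?_, ?_, ?_, ?_⟩
  · intro z hz
    rcases Finset.mem_insert.1 (Finset.mem_coe.1 hz) with rfl | hz
    · exact hx
    · exact (hE.subset hz).1
  · intro a ha b hb hab
    rcases Finset.mem_insert.1 (Finset.mem_coe.1 ha) with rfl | ha' <;>
      rcases Finset.mem_insert.1 (Finset.mem_coe.1 hb) with rfl | hb'
    · rfl
    · exact absurd hab.symm (hE.subset hb').2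
    · exact absurd hab (hE.subset ha').2
    · exact hE.injOn ha' hb' hab
  · rw [Finset.card_insert_of_notMem hxE, hE.card_eq]
  · rw [Finset.sum_insert hxE]
    have := hE.sum_le
    omega

/-- A light transversal can be changed into one through `x` by removing a single element, if no
element of it is lighter than `x`. -/
theorem exists_exchange (hE : IsLightTransversal U (k + 1) M E) {x : ι × ℕ} (hxU : x ∈ U)
    (hx : ∀ y ∈ E, x.2 ≤ y.2) :
    ∃ y ∈ E, IsLightTransversal U (k + 1) M (Insert.insert x (E.erase y)) := by
  have hsum : ∀ y ∈ E, ∑ p ∈ E, p.2 + x.2 ≤ M + y.2 := fun y hy =>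
    add_le_add hE.sum_le (hx y hy)
  by_cases h : ∃ y ∈ E, y.1 = x.1
  · obtain ⟨y, hy, hyx⟩ := h
    exact ⟨y, hy, hE.exchange hy hxU
      (fun z hz hzy hzx => hzy (hE.injOn hz hy (hzx.trans hyx.symm))) (hsum y hy)⟩
  · obtain ⟨y, hy⟩ : E.Nonempty := Finset.card_pos.1 (by rw [hE.card_eq]; omega)
    exact ⟨y, hy, hE.exchange hy hxU (fun z hz _ hzx => h ⟨z, hz, hzx⟩) (hsum y hy)⟩

end IsLightTransversal

/-! ### The least nonisolated vertex: deletion, contraction, shedding -/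

namespace IsLightTransversalHypergraph

section

variable {ι : Type*} {H : Hypergraph (ι × ℕ)} {U : Set (ι × ℕ)} {k M : ℕ}

theorem coe_mem (h : IsLightTransversalHypergraph H U k M) {E : Finset (ι × ℕ)}
    (hE : IsLightTransversal U k M E) : (E : Set (ι × ℕ)) ∈ H.edgeSet :=
  (h.mem_edgeSet _).2 ⟨E, hE, rfl⟩

theorem mem_nonisolatedSet (h : IsLightTransversalHypergraph H U (k + 2) M)
    {E : Finset (ι × ℕ)} (hE : IsLightTransversal U (k + 2) M E) {y : ι × ℕ} (hy : y ∈ E) :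
    y ∈ nonisolatedSet H := by
  refine ⟨H.subset_vertexSet_of_mem_edgeSet' (h.coe_mem hE) hy, ?_⟩
  rintro ⟨-, hs | hn⟩
  · obtain ⟨F, hF, hFy⟩ := (h.mem_edgeSet _).1 hs
    have : F = {y} := by exact_mod_cast hFy
    have := hF.card_eq
    simp_all
  · exact hn _ (h.coe_mem hE) hy

theorem isIsolated_of_one (h : IsLightTransversalHypergraph H U 1 M) {y : ι × ℕ}
    (hy : y ∈ H.vertexSet) : IsIsolated H y := by
  refine ⟨hy, ?_⟩
  by_contra! hc
  obtain ⟨hs, e, he, hye⟩ := hc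
  obtain ⟨E, hE, rfl⟩ := (h.mem_edgeSet _).1 he
  obtain ⟨z, rfl⟩ := Finset.card_eq_one.1 hE.card_eq
  have : y = z := by simpa using hye
  subst this
  exact hs (by simpa using he)

theorem exists_mem_of_mem_nonisolatedSet (h : IsLightTransversalHypergraph H U k M) {x : ι × ℕ}
    (hx : x ∈ nonisolatedSet H) : ∃ E, IsLightTransversal U k M E ∧ x ∈ E := by
  by_contra! hc
  refine hx.2 ⟨hx.1, Or.inr fun e he hxe => ?_⟩
  obtain ⟨E, hE, rfl⟩ := (h.mem_edgeSet _).1 he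
  exact hc E hE hxe

end

variable {n : ℕ} {H : Hypergraph (Fin n × ℕ)} {U : Set (Fin n × ℕ)} {k M : ℕ} {x : Fin n × ℕ}

theorem snd_le (h : IsLightTransversalHypergraph H U (k + 2) M)
    (hx : IsShadowMin (nonisolatedSet H) x) {E : Finset (Fin n × ℕ)}
    (hE : IsLightTransversal U (k + 2) M E) {y : Fin n × ℕ} (hy : y ∈ E) : x.2 ≤ y.2 := by
  by_cases hyx : y = x
  · rw [hyx]
  · rcases hx.2 y (h.mem_nonisolatedSet hE hy) hyx with h | h
    · exact h.le
    · exact h.1.le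

theorem deleteVertex (h : IsLightTransversalHypergraph H U (k + 2) M)
    (hx : IsShadowMin (nonisolatedSet H) x) :
    IsLightTransversalHypergraph (deleteVertex H x) (U \ {x}) (k + 2) M := by
  constructor
  · intro e
    constructor
    · rintro ⟨he, hxe⟩
      obtain ⟨E, hE, rfl⟩ := (h.mem_edgeSet _).1 he
      exact ⟨E, ⟨fun z hz => ⟨hE.subset hz, fun hzx => hxe (hzx ▸ hz)⟩, hE.injOn, hE.card_eq,
        hE.sum_le⟩, rfl⟩
    · rintro ⟨E, hE, rfl⟩
      exact ⟨h.coe_mem ⟨fun z hz => (hE.subset hz).1, hE.injOn, hE.card_eq, hE.sum_le⟩,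
        fun hxE => (hE.subset hxE).2 rfl⟩
  · rintro i c ⟨hU, hne⟩
    refine ⟨h.upward i c hU, ?_⟩
    -- If `x` were `(i, c + 1)` with `(i, c)` in `U`, lowering `x` to `(i, c)` in an edge would give
    -- a nonisolated vertex lighter than `x`.
    rintro rfl
    obtain ⟨E, hE, hxE⟩ := h.exists_mem_of_mem_nonisolatedSet hx.1
    have hF := hE.exchange hxE hU
      (fun z hz hzx hz1 => hzx (hE.injOn hz hxE hz1))
      (add_le_add hE.sum_le (Nat.le_succ c))
    have := h.snd_le hx hF (Finset.mem_insert_self _ _)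
    simp at this

/-- The edges avoiding the least nonisolated vertex `x` are redundant in the contraction. -/
theorem exists_edge_diff_subset (h : IsLightTransversalHypergraph H U (k + 2) M)
    (hx : IsShadowMin (nonisolatedSet H) x) {e : Set (Fin n × ℕ)} (he : e ∈ H.edgeSet) :
    ∃ f ∈ H.edgeSet, x ∈ f ∧ f \ {x} ⊆ e := by
  obtain ⟨E, hE, rfl⟩ := (h.mem_edgeSet _).1 he
  obtain ⟨E₀, hE₀, hxE₀⟩ := h.exists_mem_of_mem_nonisolatedSet hx.1
  obtain ⟨y, hy, hF⟩ := hE.exists_exchange (hE₀.subset hxE₀) fun y hy => h.snd_le hx hE hy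
  refine ⟨_, h.coe_mem hF, by simp, ?_⟩
  rintro z ⟨hz, hzx⟩
  rcases Finset.mem_insert.1 (Finset.mem_coe.1 hz) with rfl | hz
  · exact absurd rfl hzx
  · exact Finset.mem_of_mem_erase hz

theorem mem_edgeSet_contractVertex (h : IsLightTransversalHypergraph H U (k + 2) M)
    (hx : IsShadowMin (nonisolatedSet H) x) (e : Set (Fin n × ℕ)) :
    e ∈ (contractVertex H x).edgeSet ↔ ∃ E ∈ H.edgeSet, x ∈ E ∧ e = E \ {x} := by
  refine ⟨?_, Or.inl⟩
  rintro (he | ⟨he, hxe, hmin⟩)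
  · exact he
  · obtain ⟨f, hf, hxf, hfe⟩ := h.exists_edge_diff_subset hx he
    exact absurd hfe (hmin f hf fun hfe => hxe (hfe ▸ hxf))

theorem contractVertex (h : IsLightTransversalHypergraph H U (k + 2) M)
    (hx : IsShadowMin (nonisolatedSet H) x) :
    IsLightTransversalHypergraph (contractVertex H x) {p | p ∈ U ∧ p.1 ≠ x.1} (k + 1)
      (M - x.2) := by
  obtain ⟨E₀, hE₀, hxE₀⟩ := h.exists_mem_of_mem_nonisolatedSet hx.1
  -- This makes `M - x.2` a genuine difference, as is needed to put `x` back into an edge.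
  have hM : x.2 ≤ M :=
    (Finset.single_le_sum (f := fun p : Fin n × ℕ => p.2) (fun _ _ => Nat.zero_le _) hxE₀).trans
      hE₀.sum_le
  refine ⟨fun e => ?_, fun i c hic => ⟨h.upward i c hic.1, hic.2⟩⟩
  rw [h.mem_edgeSet_contractVertex hx]
  constructor
  · rintro ⟨e, he, hxE, rfl⟩
    obtain ⟨E, hE, rfl⟩ := (h.mem_edgeSet _).1 he
    exact ⟨_, hE.erase hxE, Finset.coe_erase x E⟩
  · rintro ⟨E, hE, rfl⟩
    obtain ⟨hxE, hF⟩ := hE.insert (hE₀.subset hxE₀) hM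
    exact ⟨_, h.coe_mem hF, by simp, by simp [hxE]⟩

/-- Suppose a face `S` of the link is maximal in the deletion. Some edge through `x` has an element
`(j, c)` outside `insert x S`. By maximality and exchange, `(j, c + 1)` is again a vertex outside
`S`; iterating pushes the weight past `M`, which no element of an edge can exceed. -/
theorem isShedding (h : IsLightTransversalHypergraph H U (k + 2) M)
    (hx : IsShadowMin (nonisolatedSet H) x) : IsShedding H x := by
  classical
  obtain ⟨E₀, hE₀, hxE₀⟩ := h.exists_mem_of_mem_nonisolatedSet hx.1
  have hxU : x ∈ U := hE₀.subset hxE₀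
  constructor
  · refine ⟨by simpa using hx.1.1, fun e he hex => ?_⟩
    obtain ⟨E, hE, rfl⟩ := (h.mem_edgeSet _).1 he
    have := Finset.card_le_card (Finset.coe_subset.1 hex)
    rw [hE.card_eq, Finset.card_singleton] at this
    omega
  rintro S ⟨hS, hxS, -, hxSind⟩
  have hind : ∀ E, IsLightTransversal U (k + 2) M E → ¬ E ⊆ insert x S := fun E hE hES =>
    hxSind _ (h.coe_mem hE) fun z hz => by simpa using hES hz
  by_contra! hfacet
  -- By maximality of `S`, every other vertex completes an edge.
  have hcompl : ∀ y ∈ H.vertexSet, y ∉ S → y ≠ x →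
      ∃ E, IsLightTransversal U (k + 2) M E ∧ y ∈ E ∧ E ⊆ insert y S := by
    intro y hyV hyS hyx
    by_contra! hc
    refine hfacet (insert y S) ⟨⟨?_, ?_⟩, ?_⟩ (Finset.ssubset_insert hyS)
    · intro z hz
      rcases Finset.mem_insert.1 (Finset.mem_coe.1 hz) with rfl | hz
      · exact hyV
      · exact hS.1 hz
    · intro e he hes
      obtain ⟨E, hE, rfl⟩ := (h.mem_edgeSet _).1 he
      have hes := Finset.coe_subset.1 hes
      by_cases hyE : y ∈ E
      · exact hc E hE hyE hes
      · exact hS.2 _ he fun z hz => Finset.mem_of_mem_insert_of_ne (hes hz)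
          fun hzy => hyE (hzy ▸ hz)
    · simp [hxS, Ne.symm hyx]
  -- Raising the weight of a vertex outside `S` yields again a vertex outside `S`.
  have hstep : ∀ j c, j ≠ x.1 → (j, c) ∈ H.vertexSet → (j, c) ∉ S →
      c ≤ M ∧ (j, c + 1) ∈ H.vertexSet ∧ (j, c + 1) ∉ S := by
    intro j c hj hV hjS
    obtain ⟨E, hE, hjE, hES⟩ := hcompl (j, c) hV hjS (fun hjx => hj (by rw [← hjx]))
    have hcM : c ≤ M := (Finset.single_le_sum (f := fun p : Fin n × ℕ => p.2)
      (fun _ _ => Nat.zero_le _) hjE).trans hE.sum_le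
    have herase : E.erase (j, c) ⊆ S := fun z hz =>
      Finset.mem_of_mem_insert_of_ne (hES (Finset.mem_of_mem_erase hz)) (Finset.ne_of_mem_erase hz)
    by_cases hi : ∃ z ∈ E, z.1 = x.1
    · obtain ⟨z, hz, hzx⟩ := hi
      have hzj : z ≠ (j, c) := by rintro rfl; exact hj hzx
      have hzS : z ∈ S := herase (Finset.mem_erase.2 ⟨hzj, hz⟩)
      have hlt : x.2 < z.2 := lt_of_le_of_ne (h.snd_le hx hE hz) fun h2 =>
        hxS ((Prod.ext hzx h2.symm : z = x) ▸ hzS)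
      have hjF : (j, c) ∈ insert x (E.erase z) := by simp [Ne.symm hzj, hjE]
      have hF := hE.exchange hz hxU
        (fun y hy hyz hyx => hyz (hE.injOn hy hz (hyx.trans hzx.symm)))
        (add_le_add hE.sum_le hlt.le)
      -- Replacing `z` by the strictly lighter `x` in the same row frees a unit of weight, which is
      -- spent on raising `(j, c)` to `(j, c + 1)`.
      have hsum : ∑ p ∈ insert x (E.erase z), p.2 + 1 ≤ M := by
        have hxE : x ∉ E.erase z := fun hxE => Finset.ne_of_mem_erase hxE
          (hE.injOn (Finset.mem_of_mem_erase hxE) hz hzx.symm)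
        rw [Finset.sum_insert hxE]
        have := Finset.add_sum_erase E (fun p : Fin n × ℕ => p.2) hz
        have := hE.sum_le
        omega
      have hG := hF.exchange hjF (h.upward j c (hE.subset hjE))
        (fun y hy hyj hy1 => hyj (hF.injOn hy hjF hy1))
        (by simp only; omega)
      refine ⟨hcM, H.subset_vertexSet_of_mem_edgeSet' (h.coe_mem hG) (by simp), fun hS' =>
        hind _ hG fun y hy => ?_⟩
      rcases Finset.mem_insert.1 hy with rfl | hy
      · exact Finset.mem_insert_of_mem hS'
      · obtain ⟨hyj, hy⟩ := Finset.mem_erase.1 hy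
        rcases Finset.mem_insert.1 hy with rfl | hy
        · exact Finset.mem_insert_self _ _
        · exact Finset.mem_insert_of_mem
            (herase (Finset.mem_erase.2 ⟨hyj, Finset.mem_of_mem_erase hy⟩))
    -- If `E` misses the row of `x`, exchanging `(j, c)` for `x` gives an edge inside `insert x S`,
    -- which is independent.
    · refine absurd (Finset.insert_subset_insert x herase) (hind _ (hE.exchange hjE hxU
        (fun z hz _ hzx => hi ⟨z, hz, hzx⟩) ?_))
      exact add_le_add hE.sum_le (h.snd_le hx hE hjE)
  obtain ⟨⟨j, c⟩, hy, hyxS⟩ := Finset.not_subset.1 (hind E₀ hE₀)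
  rw [Finset.mem_insert, not_or] at hyxS
  have hj : j ≠ x.1 := fun hj => hyxS.1 (hE₀.injOn hy hxE₀ hj)
  have hV : (j, c) ∈ H.vertexSet := H.subset_vertexSet_of_mem_edgeSet' (h.coe_mem hE₀) hy
  have hall : ∀ d, (j, c + d) ∈ H.vertexSet ∧ (j, c + d) ∉ S := by
    intro d
    induction d with
    | zero => exact ⟨hV, hyxS.2⟩
    | succ d ih => exact (hstep j (c + d) hj ih.1 ih.2).2
  have := (hstep j _ hj (hall (M + 1)).1 (hall (M + 1)).2).1
  omega

/-- An edge inside `insert x S` can be traded for one through `x` whose remaining elements lie in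
the first, hence in `S`; so edges of the contraction detect all dependence. -/
theorem link_eq (h : IsLightTransversalHypergraph H U (k + 2) M)
    (hx : IsShadowMin (nonisolatedSet H) x) :
    (independenceComplex H).link x = independenceComplex (SkeletonVD.contractVertex H x) := by
  classical
  ext S
  constructor
  · rintro ⟨hS, hxS, -, hind⟩
    refine ⟨fun z hz => ⟨hS.1 hz, fun hzx => hxS (hzx ▸ hz)⟩, fun e he hes => ?_⟩
    obtain ⟨E, hE, -, rfl⟩ := (h.mem_edgeSet_contractVertex hx e).1 he
    refine hind E hE fun z hz => ?_
    by_cases hzx : z = x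
    · simp [hzx]
    · simpa [hzx] using hes ⟨hz, hzx⟩
  · rintro ⟨hS, hind⟩
    have hxS : x ∉ S := fun hxS => (hS hxS).2 rfl
    have hins : ∀ e ∈ H.edgeSet, ¬ e ⊆ insert x (S : Set (Fin n × ℕ)) := by
      intro e he hes
      obtain ⟨f, hf, hxf, hfe⟩ := h.exists_edge_diff_subset hx he
      refine hind _ ((h.mem_edgeSet_contractVertex hx _).2 ⟨f, hf, hxf, rfl⟩) fun z hz => ?_
      exact (hes (hfe hz)).resolve_left hz.2
    refine ⟨⟨fun z hz => (hS hz).1, fun e he hes => hins e he (hes.trans (Set.subset_insert _ _))⟩,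
      hxS, ?_, ?_⟩
    · intro z hz
      have hz : z = x ∨ z ∈ S := by simpa using hz
      rcases hz with rfl | hz
      · exact hx.1.1
      · exact (hS hz).1
    · simpa using hins

end IsLightTransversalHypergraph

/-! ### Independence complexes and the induction on the number of vertices -/

theorem deletion_independenceComplex {α : Type*} (H : Hypergraph α) (x : α) :
    (independenceComplex H).deletion x = independenceComplex (deleteVertex H x) := by
  ext S
  constructor
  · rintro ⟨hS, hxS⟩
    exact ⟨fun z hz => ⟨hS.1 hz, fun hzx => hxS (hzx ▸ hz)⟩, fun e he => hS.2 e he.1⟩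
  · rintro ⟨hS, hind⟩
    have hxS : x ∉ S := fun hxS => (hS hxS).2 rfl
    exact ⟨⟨fun z hz => (hS hz).1, fun e he hes => hind e ⟨he, fun hxe => hxS (hes hxe)⟩ hes⟩, hxS⟩

/-- The only facet consists of the vertices that are not singleton edges. An empty edge would leave
no faces at all, hence `hne`. -/
theorem isSimplex_independenceComplex {α : Type*} {H : Hypergraph α} (hfin : H.vertexSet.Finite)
    (hne : ∀ e ∈ H.edgeSet, e.Nonempty) (hiso : ∀ x ∈ H.vertexSet, IsIsolated H x) :
    (independenceComplex H).IsSimplex := by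
  have hfin' : {x | x ∈ H.vertexSet ∧ {x} ∉ H.edgeSet}.Finite := hfin.subset fun x hx => hx.1
  have hmem : hfin'.toFinset ∈ (independenceComplex H).faces := by
    refine ⟨fun z hz => ((hfin'.mem_toFinset).1 hz).1, fun e he hes => ?_⟩
    obtain ⟨y, hy⟩ := hne e he
    have hy' := (hfin'.mem_toFinset).1 (hes hy)
    exact (hiso y hy'.1).2.elim hy'.2 fun hn => hn e he hy
  have hmax : ∀ S ∈ (independenceComplex H).faces, S ⊆ hfin'.toFinset := fun S hS z hz =>
    (hfin'.mem_toFinset).2 ⟨hS.1 hz, fun he => hS.2 _ he (by simpa using hz)⟩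
  exact ⟨_, ⟨hmem, fun S hS hle => hle.antisymm (hmax S hS)⟩, fun S hS => hS.2 _ hmem (hmax S hS.1)⟩

theorem exists_isShadowMin {n : ℕ} {S : Set (Fin n × ℕ)} (hfin : S.Finite) (hne : S.Nonempty) :
    ∃ x, IsShadowMin S x := by
  obtain ⟨x, hx, hmin⟩ := Set.exists_min_image S
    (fun p : Fin n × ℕ => toLex (p.2, p.1)) hfin hne
  refine ⟨x, hx, fun y hy hyx => ?_⟩
  rcases Prod.Lex.le_iff.1 (hmin y hy) with h | ⟨h₁, h₂⟩
  · exact Or.inl h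
  · exact Or.inr ⟨h₁, lt_of_le_of_ne h₂ fun h => hyx (Prod.ext h.symm h₁.symm)⟩

theorem IsLightTransversalHypergraph.decomposable {n : ℕ} {H : Hypergraph (Fin n × ℕ)}
    {U : Set (Fin n × ℕ)} {k M : ℕ} (h : IsLightTransversalHypergraph H U (k + 1) M)
    (hfin : H.vertexSet.Finite) : IsVertexDecomposable H ∧ ShadowDecomposable H := by
  induction hN : H.vertexSet.ncard using Nat.strong_induction_on generalizing H U k M with
  | _ N ih =>
  subst hN
  by_cases hiso : ∀ x ∈ H.vertexSet, IsIsolated H x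
  · refine ⟨.simplex _ (isSimplex_independenceComplex hfin (fun e he => ?_) hiso),
      .isolated _ hiso⟩
    obtain ⟨E, hE, rfl⟩ := (h.mem_edgeSet _).1 he
    exact Finset.coe_nonempty.2 (Finset.card_pos.1 (by rw [hE.card_eq]; omega))
  · cases k with
    | zero => exact absurd (fun x hx => h.isIsolated_of_one hx) hiso
    | succ k =>
      push Not at hiso
      obtain ⟨x, hx⟩ := exists_isShadowMin (S := nonisolatedSet H) (hfin.subset fun x hx => hx.1)
        hiso
      have hlt : (H.vertexSet \ {x}).ncard < H.vertexSet.ncard :=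
        Set.ncard_sdiff_singleton_lt_of_mem hx.1.1 hfin
      have hdel := ih _ hlt (h.deleteVertex hx) hfin.sdiff rfl
      have hcon := ih _ hlt (h.contractVertex hx) hfin.sdiff rfl
      refine ⟨.shed _ x (h.isShedding hx) ?_ ?_, .shed _ x hx (h.isShedding hx) hdel.2 hcon.2⟩
      · rw [deletion_independenceComplex]
        exact hdel.1
      · rw [h.link_eq hx]
        exact hcon.1

/-! ### Skeletons of the simplex and their duplicated hypergraphs -/

theorem AbsComplex.IsSimplex.mem_faces {α : Type*} [Fintype α] {Γ : AbsComplex α}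
    (hΓ : Γ.IsSimplex) (hV : Γ.vertexSet = Set.univ) (F : Finset α) : F ∈ Γ.faces := by
  obtain ⟨T, hT, huniq⟩ := hΓ
  refine Γ.down_closed T hT.1 F fun x _ => ?_
  have hx : {x} ∈ Γ.faces := by
    change x ∈ Γ.vertexSet
    simp [hV]
  obtain ⟨G, hxG, hG⟩ := (Set.toFinite Γ.faces).exists_le_maximal hx
  rw [← huniq G ⟨hG.prop, fun K hK hGK => le_antisymm hGK (hG.le_of_ge hK hGK)⟩]
  exact Finset.singleton_subset_iff.1 hxG

theorem AbsComplex.isFacet_skeleton_iff {n s : ℕ} (hs : s < n) {Γ : AbsComplex (Fin n)}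
    (hΓ : ∀ F, F ∈ Γ.faces) (F : Finset (Fin n)) :
    (Γ.skeleton s).IsFacet F ↔ F.card = s + 1 := by
  constructor
  · rintro ⟨⟨-, hF⟩, hmax⟩
    obtain ⟨G, hFG, hG⟩ := Finset.exists_superset_card_eq hF (by simpa using hs)
    rw [hmax G ⟨hΓ G, hG.le⟩ hFG, hG]
  · intro hF
    exact ⟨⟨hΓ F, hF.le⟩, fun G hG hFG =>
      Finset.eq_of_subset_of_card_le hFG (hF ▸ hG.2)⟩

theorem isLightTransversalHypergraph_duplicate {n s ℓ : ℕ} {K : Hypergraph (Fin n)}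
    (hK : ∀ F : Finset (Fin n), (F : Set (Fin n)) ∈ K.edgeSet ↔ F.card = s + 1) :
    IsLightTransversalHypergraph (duplicate K ℓ) {p | 1 ≤ p.2} (s + 1) (ℓ + s) := by
  refine ⟨fun e => ⟨?_, ?_⟩, fun i c hc => Nat.le_succ_of_le hc⟩
  · rintro ⟨F, hF, f, hf, hsum, rfl⟩
    rw [hK] at hF
    have hinj : Function.Injective fun x : Fin n => (x, f x) := fun a b hab =>
      congrArg Prod.fst hab
    refine ⟨F.image fun x => (x, f x), ⟨?_, ?_, ?_, ?_⟩, Finset.coe_image⟩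
    · intro p hp
      obtain ⟨x, hx, rfl⟩ := Finset.mem_image.1 (Finset.mem_coe.1 hp)
      exact (hf x hx).1
    · intro p hp q hq hpq
      obtain ⟨x, hx, rfl⟩ := Finset.mem_image.1 (Finset.mem_coe.1 hp)
      obtain ⟨y, hy, rfl⟩ := Finset.mem_image.1 (Finset.mem_coe.1 hq)
      simp only at hpq
      rw [hpq]
    · rw [Finset.card_image_of_injective _ hinj, hF]
    · rw [Finset.sum_image fun a _ b _ hab => hinj hab]
      simp only
      omega
  · rintro ⟨E, hE, rfl⟩
    have hg : ∀ i, ∃ c, ∀ p ∈ E, p.1 = i → p.2 = c := by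
      intro i
      by_cases hi : ∃ p ∈ E, p.1 = i
      · obtain ⟨p, hp, rfl⟩ := hi
        exact ⟨p.2, fun q hq hqp => congrArg Prod.snd (hE.injOn hq hp hqp)⟩
      -- The value on rows that `E` misses is irrelevant.
      · exact ⟨0, fun p hp hpi => absurd ⟨p, hp, hpi⟩ hi⟩
    choose f hf using hg
    have hfE : ∀ p ∈ E, (p.1, f p.1) = p := fun p hp => Prod.ext rfl (hf p.1 p hp rfl).symm
    have hcard : (E.image Prod.fst).card = s + 1 := by
      rw [Finset.card_image_of_injOn hE.injOn, hE.card_eq]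
    have hsum : ∑ x ∈ E.image Prod.fst, f x ≤ ℓ + s := by
      rw [Finset.sum_image hE.injOn, Finset.sum_congr rfl fun p hp => (hf p.1 p hp rfl).symm]
      exact hE.sum_le
    have hpos : ∀ x ∈ E.image Prod.fst, 1 ≤ f x := by
      intro x hx
      obtain ⟨p, hp, rfl⟩ := Finset.mem_image.1 hx
      exact hf p.1 p hp rfl ▸ hE.subset hp
    refine ⟨E.image Prod.fst, (hK _).2 hcard, f, fun x hx => ⟨hpos x hx, ?_⟩, by omega, ?_⟩
    -- The bound `f x ≤ ℓ` is automatic: the other `s` weights are at least 1 and the total is at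
    -- most `ℓ + s`.
    · have h₁ : f x + ∑ y ∈ (E.image Prod.fst).erase x, f y = ∑ y ∈ E.image Prod.fst, f y :=
        Finset.add_sum_erase _ f hx
      have h₂ : ((E.image Prod.fst).erase x).card • 1 ≤ ∑ y ∈ (E.image Prod.fst).erase x, f y :=
        Finset.card_nsmul_le_sum _ _ _ fun y hy => hpos y (Finset.mem_of_mem_erase hy)
      rw [Finset.card_erase_of_mem hx, hcard, smul_eq_mul] at h₂
      omega
    · rw [Finset.coe_image, Set.image_image]
      exact ((Set.image_congr hfE).trans (Set.image_id' _)).symm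

theorem finite_vertexSet_duplicate {ι : Type*} [Finite ι] (K : Hypergraph ι) (ℓ : ℕ) :
    (duplicate K ℓ).vertexSet.Finite := by
  refine (Set.finite_univ.prod (Set.finite_Iic ℓ)).subset ?_
  rintro p ⟨F, -, -, -, hp⟩
  exact ⟨Set.mem_univ _, hp⟩

end SkeletonVD

theorem theorem4p2 (n s ℓ : ℕ) (hs : s < n) (hℓ : 1 ≤ ℓ)
    (Γ : SkeletonVD.AbsComplex (Fin n)) (hΓ : Γ.IsSimplex) (hV : Γ.vertexSet = Set.univ) :
    SkeletonVD.IsVertexDecomposable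
        (SkeletonVD.duplicate (Γ.skeleton s).facetHypergraph ℓ) ∧
      SkeletonVD.ShadowDecomposable
        (SkeletonVD.duplicate (Γ.skeleton s).facetHypergraph ℓ) := by
  refine (SkeletonVD.isLightTransversalHypergraph_duplicate (s := s) fun F => ?_).decomposable
    (SkeletonVD.finite_vertexSet_duplicate _ ℓ)
  rw [← SkeletonVD.AbsComplex.isFacet_skeleton_iff hs (hΓ.mem_faces hV)]
  constructor
  · rintro ⟨G, hG, hFG⟩
    rwa [Finset.coe_injective hFG]
  · exact fun hF => ⟨F, hF, rfl⟩
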